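/- Let $f\colon\mathbb{R}^N\to(-\infty,+\infty]$ be proper, lower semicontinuous and convex, with $\operatorname{dom} f=\{x: f(x)<+\infty\}$. Let $R\in\mathbb{R}^{m\times N}$ and $S\in\mathbb{R}^{n\times N}$ be real matrices with $RR^*$ invertible, let $c\in\mathbb{R}^m$, $d\in\mathbb{R}^n$, and set $L\colon\mathbb{R}^N\to\mathbb{R}^{m+n}$, $Lx=(Rx,Sx)$, and $b=(c,d)$. Consider the problem $$\min_{x\in\mathbb{R}^N} f(x)\quad\text{s.t.}\quad Rx=c,\ Sx=d,$$ and suppose that it has a solution and that $0\in\operatorname{sri}(L(\operatorname{dom} f)-b)$, where $\operatorname{sri} C$ is the set of those $z\in C$ for which the cone $\bigcup_{\lambda>0}\lambda(C-z)$ is the closed linear span of $C-z$. Let $\gamma>0$ and $\tau>0$ be such that $\gamma\tau\|L\|^2<1$, let $x^0=\bar x^0\in\mathbb{R}^N$ and $u^0\in\mathbb{R}^{m+n}$, and for every $k\in\mathbb{N}$ let $$\begin{aligned} u^{k+1}&=u^k+\gamma(L\bar x^k-b),\\ p^{k+1}&=\operatorname{prox}_{\tau f}(x^k-\tau L^*u^{k+1}),\\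 x^{k+1}&=p^{k+1}-R^*(RR^*)^{-1}(Rp^{k+1}-c),\\ \bar x^{k+1}&=x^{k+1}+p^{k+1}-x^k, \end{aligned}$$ where $\operatorname{prox}_{\tau f}(z)$ is the unique minimizer of $y\mapsto \tau f(y)+\tfrac12\|y-z\|^2$. Then there exist a solution $\hat x$ of the problem and an associated Lagrange multiplier $\hat u\in\mathbb{R}^{m+n}$, i.e. $-L^*\hat u\in\partial f(\hat x)$, such that $x^k\to\hat x$ and $u^k\to\hat u$. -/

import Mathlib

open Set Filter Topology

noncomputable section

namespace ProjCP

section General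

variable {E : Type*} [NormedAddCommGroup E] [InnerProductSpace ℝ E]

/-- The effective domain of an extended-real-valued function. -/
def effDom (f : E → EReal) : Set E := {x | f x < ⊤}

/-- The class of proper lower semicontinuous convex functions with values in `(-∞, +∞]`. -/
structure IsGammaZero (f : E → EReal) : Prop where
  ne_bot : ∀ x, f x ≠ ⊥
  dom_nonempty : (effDom f).Nonempty
  lsc : LowerSemicontinuous f
  convex : ∀ x y : E, ∀ a b : ℝ, 0 < a → 0 < b → a + b = 1 →
    f (a • x + b • y) ≤ (a : EReal) * f x + (b : EReal) * f y

/-- The subdifferential of `f` at `x`. -/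
def subdiff (f : E → EReal) (x : E) : Set E :=
  {v | ∀ y : E, f x + ((inner ℝ v (y - x) : ℝ) : EReal) ≤ f y}

/-- `p` is the proximal point of `g` at `z`, i.e. `p` minimizes `y ↦ g y + ‖y - z‖² / 2`
(for a proper lower semicontinuous convex `g` there is exactly one such `p`). -/
def IsProx (g : E → EReal) (z p : E) : Prop :=
  ∀ y : E, g p + ((‖p - z‖ ^ 2 / 2 : ℝ) : EReal) ≤ g y + ((‖y - z‖ ^ 2 / 2 : ℝ) : EReal)

/-- The strong relative interior of a set `C`: the points `x` of `C` such that the cone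
generated by `C - x` is the closed linear span of `C - x`. -/
def sri (C : Set E) : Set E :=
  {x | x ∈ C ∧
    {v : E | ∃ t : ℝ, 0 < t ∧ ∃ w ∈ C, v = t • (w - x)} =
      ((Submodule.span ℝ ((fun w => w - x) '' C)).topologicalClosure : Set E)}

end General

variable {N m n : ℕ}

/-- A real matrix as a continuous linear map between Euclidean spaces. -/
def matCLM {ι κ : Type*} [Fintype ι] [Fintype κ] [DecidableEq κ] (A : Matrix ι κ ℝ) :
    EuclideanSpace ℝ κ →L[ℝ] EuclideanSpace ℝ ι :=
  LinearMap.toContinuousLinearMap (Matrix.toLpLin 2 2 A)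

/-- The operator `L : x ↦ (R x, S x)`, with values in the Euclidean space of dimension `m + n`
(its coordinates are indexed by `Fin m ⊕ Fin n`). -/
def stackOp (R : Matrix (Fin m) (Fin N) ℝ) (S : Matrix (Fin n) (Fin N) ℝ) :
    EuclideanSpace ℝ (Fin N) →L[ℝ] EuclideanSpace ℝ (Fin m ⊕ Fin n) :=
  matCLM (Matrix.fromRows R S)

/-- The vector `b = (c, d)`. -/
def stackVec (c : EuclideanSpace ℝ (Fin m)) (d : EuclideanSpace ℝ (Fin n)) :
    EuclideanSpace ℝ (Fin m ⊕ Fin n) :=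
  WithLp.toLp 2 (Sum.elim c d)

/-- `x` solves: minimize `f x` subject to `R x = c` and `S x = d`. -/
def IsSolution (f : EuclideanSpace ℝ (Fin N) → EReal)
    (R : Matrix (Fin m) (Fin N) ℝ) (S : Matrix (Fin n) (Fin N) ℝ)
    (c : EuclideanSpace ℝ (Fin m)) (d : EuclideanSpace ℝ (Fin n))
    (x : EuclideanSpace ℝ (Fin N)) : Prop :=
  matCLM R x = c ∧ matCLM S x = d ∧
    ∀ y, matCLM R y = c → matCLM S y = d → f x ≤ f y

/-- `u` is a Lagrange multiplier associated with the solution `x`, i.e. `-L* u ∈ ∂f(x)`. -/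
def IsMultiplier (f : EuclideanSpace ℝ (Fin N) → EReal)
    (R : Matrix (Fin m) (Fin N) ℝ) (S : Matrix (Fin n) (Fin N) ℝ)
    (x : EuclideanSpace ℝ (Fin N)) (u : EuclideanSpace ℝ (Fin m ⊕ Fin n)) : Prop :=
  -(ContinuousLinearMap.adjoint (stackOp R S) u) ∈ subdiff f x

/-- The sequences `x`, `p`, `xbar`, `u` are generated by the projected primal-dual routine
(the entry `p 0` plays no role). -/
structure IsRoutine (f : EuclideanSpace ℝ (Fin N) → EReal)
    (R : Matrix (Fin m) (Fin N) ℝ) (S : Matrix (Fin n) (Fin N) ℝ)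
    (c : EuclideanSpace ℝ (Fin m)) (d : EuclideanSpace ℝ (Fin n)) (γ τ : ℝ)
    (x p xbar : ℕ → EuclideanSpace ℝ (Fin N))
    (u : ℕ → EuclideanSpace ℝ (Fin m ⊕ Fin n)) : Prop where
  init : xbar 0 = x 0
  dual_step : ∀ k, u (k + 1) = u k + γ • (stackOp R S (xbar k) - stackVec c d)
  prox_step : ∀ k, IsProx (fun y => (τ : EReal) * f y)
    (x k - τ • ContinuousLinearMap.adjoint (stackOp R S) (u (k + 1))) (p (k + 1))
  proj_step : ∀ k, x (k + 1) =
    p (k + 1) - matCLM R.transpose (matCLM (R * R.transpose)⁻¹ (matCLM R (p (k + 1)) - c))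
  extrap_step : ∀ k, xbar (k + 1) = x (k + 1) + p (k + 1) - x k

end ProjCP

end

namespace ProjCP

/-! ### Subdifferentials, proximal points and existence of multipliers. -/

section ConvexAnalysis

variable {E F : Type*} [NormedAddCommGroup E] [InnerProductSpace ℝ E]
  [NormedAddCommGroup F] [InnerProductSpace ℝ F]

/-! The qualification condition provides one multiplier (`exists_multiplier`, via
`riesz_extension`), hence a saddle point to measure distances from. With `q k = xbar k - x k`, which
equals `p k - x (k - 1)` for `k ≥ 1`, the energy `lyapunov` decreases along the iteration for every
saddle point (`lyapunov_descent`). Monotonicity of the subdifferential handles the prox step, the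
extrapolation makes the cross terms telescope, and the projection only has to bring points no
farther from the constraint set. The step-size condition makes the energy coercive and its decrease
control `q k` and `u (k + 1) - u k`, which therefore vanish. A cluster point of the bounded iterates
is then a saddle point; the energy based at it is monotone and tends to 0 along a subsequence, so it
tends to 0 and the whole sequence converges. -/

theorem mem_subdiff_iff {f : E → EReal} (hf : ∀ x, f x ≠ ⊥) {x v : E} :
    v ∈ subdiff f x ↔
      ∀ y (r : ℝ), f y ≤ r → f x ≤ ((r - inner ℝ v (y - x) : ℝ) : EReal) := by
  constructor
  · intro h y r hr
    have h1 := (h y).trans hr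
    rw [EReal.coe_sub, EReal.le_sub_iff_add_le (by simp) (by simp)]
    exact h1
  · intro h y
    induction hy : f y with
    | bot => exact absurd hy (hf y)
    | top => exact le_top
    | coe r =>
      have h1 := h y r hy.le
      rwa [EReal.coe_sub, EReal.le_sub_iff_add_le (by simp) (by simp)] at h1

theorem IsGammaZero.le_combo {f : E → EReal} (hf : IsGammaZero f) {x y : E} {r s a b : ℝ}
    (hx : f x ≤ r) (hy : f y ≤ s) (ha : 0 < a) (hb : 0 < b) (hab : a + b = 1) :
    f (a • x + b • y) ≤ ((a * r + b * s : ℝ) : EReal) := by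
  refine (hf.convex x y a b ha hb hab).trans ?_
  rw [EReal.coe_add, EReal.coe_mul, EReal.coe_mul]
  gcongr

/-- The graph of the subdifferential is closed. -/
theorem mem_subdiff_of_tendsto {f : E → EReal} (hf : IsGammaZero f) {p v : ℕ → E} {x w : E}
    (hp : Tendsto p atTop (𝓝 x)) (hv : Tendsto v atTop (𝓝 w))
    (h : ∀ k, v k ∈ subdiff f (p k)) : w ∈ subdiff f x := by
  rw [mem_subdiff_iff hf.ne_bot]
  intro y r hr
  by_contra! hlt
  obtain ⟨s, hs1, hs2⟩ := EReal.lt_iff_exists_real_btwn.1 hlt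
  have h1 : ∀ᶠ k in atTop, (s : EReal) < f (p k) := hp.eventually (hf.lsc x s hs2)
  have h2 : Tendsto (fun k => r - inner ℝ (v k) (y - p k)) atTop
      (𝓝 (r - inner ℝ w (y - x))) :=
    tendsto_const_nhds.sub (hv.inner (tendsto_const_nhds.sub hp))
  have h3 := h2.eventually (gt_mem_nhds (EReal.coe_lt_coe_iff.1 hs1))
  obtain ⟨k, hk1, hk2⟩ := (h1.and h3).exists
  have h4 := (mem_subdiff_iff hf.ne_bot).1 (h k) y r hr
  exact absurd (hk1.trans_le h4) (not_lt.2 (EReal.coe_le_coe_iff.2 hk2.le))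

theorem nonneg_of_forall_add_mul {a b : ℝ} (h : ∀ t : ℝ, 0 < t → t < 1 → 0 ≤ a + t * b) :
    0 ≤ a := by
  have hlim : Tendsto (fun t : ℝ => a + t * b) (𝓝[>] 0) (𝓝 a) := by
    have : Tendsto (fun t : ℝ => a + t * b) (𝓝 0) (𝓝 (a + 0 * b)) :=
      Continuous.tendsto (by fun_prop) 0
    rw [zero_mul, add_zero] at this
    exact this.mono_left nhdsWithin_le_nhds
  refine ge_of_tendsto hlim ?_
  filter_upwards [Ioo_mem_nhdsGT (zero_lt_one (α := ℝ))] with t ht using h t ht.1 ht.2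

theorem exists_real_of_le {X : Type*} {f : X → EReal} (hf : ∀ x, f x ≠ ⊥) {x : X} {r : ℝ} (h : f x ≤ r) :
    ∃ a : ℝ, f x = a := by
  induction hy : f x with
  | bot => exact absurd hy (hf x)
  | top => simp [hy] at h
  | coe a => exact ⟨a, rfl⟩

theorem IsProx.exists_real {f : E → EReal} (hf : IsGammaZero f) {τ : ℝ} (hτ : 0 < τ) {z p : E}
    (h : IsProx (fun y => (τ : EReal) * f y) z p) : ∃ a : ℝ, f p = a := by
  induction hp : f p with
  | bot => exact absurd hp (hf.ne_bot p)
  | coe a => exact ⟨a, rfl⟩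
  | top =>
    obtain ⟨y, hy⟩ := hf.dom_nonempty
    obtain ⟨s, hs⟩ : ∃ s : ℝ, f y = s := ⟨_, (EReal.coe_toReal (ne_of_lt hy) (hf.ne_bot y)).symm⟩
    have h1 := h y
    simp only [hp, hs, EReal.coe_mul_top_of_pos hτ, EReal.top_add_coe] at h1
    refine absurd (top_le_iff.1 h1) ?_
    rw [← EReal.coe_mul, ← EReal.coe_add]
    exact EReal.coe_ne_top _

/-- The optimality condition for the proximal point. -/
theorem IsProx.mem_subdiff {f : E → EReal} (hf : IsGammaZero f) {τ : ℝ} (hτ : 0 < τ) {z p : E}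
    (h : IsProx (fun y => (τ : EReal) * f y) z p) : τ⁻¹ • (z - p) ∈ subdiff f p := by
  obtain ⟨a, ha⟩ := h.exists_real hf hτ
  rw [mem_subdiff_iff hf.ne_bot]
  intro y r hr
  rw [ha, EReal.coe_le_coe_iff]
  -- Compare `p` with the point at parameter `t` of the segment towards `y` and divide by `t`;
  -- letting `t → 0` removes the quadratic term.
  have key : ∀ t : ℝ, 0 < t → t < 1 →
      0 ≤ (τ * (r - a) + inner ℝ (p - z) (y - p)) + t * (‖y - p‖ ^ 2 / 2) := by
    intro t ht0 ht1
    have h1 := hf.le_combo ha.le hr (sub_pos.2 ht1) ht0 (by ring)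
    obtain ⟨s, hs⟩ := exists_real_of_le hf.ne_bot h1
    have h2 := h ((1 - t) • p + t • y)
    rw [hs, EReal.coe_le_coe_iff] at h1
    simp only [ha, hs] at h2
    rw [← EReal.coe_mul, ← EReal.coe_mul, ← EReal.coe_add, ← EReal.coe_add,
      EReal.coe_le_coe_iff] at h2
    have e : (1 - t) • p + t • y - z = (p - z) + t • (y - p) := by module
    rw [e, norm_add_sq_real, inner_smul_right, norm_smul, mul_pow, Real.norm_eq_abs, sq_abs] at h2
    have h3 : τ * s ≤ τ * ((1 - t) * a + t * r) := by gcongr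
    have h4 : 0 ≤ t * ((τ * (r - a) + inner ℝ (p - z) (y - p)) + t * (‖y - p‖ ^ 2 / 2)) := by
      linarith
    exact nonneg_of_mul_nonneg_right h4 ht0
  have h5 := nonneg_of_forall_add_mul key
  rw [real_inner_smul_left, ← neg_sub p z, inner_neg_left]
  have h6 : τ⁻¹ * (τ * (r - a)) = r - a := by field_simp
  have h7 := mul_nonneg (inv_nonneg.2 hτ.le) h5
  rw [mul_add, h6] at h7
  linarith

theorem subdiff_monotone {f : E → EReal} (hf : IsGammaZero f) {x y v w : E} {a b : ℝ}
    (hx : f x = a) (hy : f y = b) (hv : v ∈ subdiff f x) (hw : w ∈ subdiff f y) :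
    0 ≤ inner ℝ (v - w) (x - y) := by
  have h1 := (mem_subdiff_iff hf.ne_bot).1 hv y b hy.le
  have h2 := (mem_subdiff_iff hf.ne_bot).1 hw x a hx.le
  rw [hx, EReal.coe_le_coe_iff] at h1
  rw [hy, EReal.coe_le_coe_iff] at h2
  rw [← neg_sub x y, inner_neg_right] at h1
  rw [inner_sub_left]
  linarith

/-- The cone in `K × ℝ` generated by the pairs `(L y - b, r - a)` with `f y ≤ r`. -/
def perturbationCone (f : E → EReal) (hf : IsGammaZero f) (L : E →L[ℝ] F) (b : F) (a : ℝ) (x : E)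
    (hx : L x = b) (ha : f x = a) (K : Submodule ℝ F) : PointedCone ℝ (K × ℝ) where
  carrier := {z | ∃ t : ℝ, 0 < t ∧ ∃ (y : E) (r : ℝ), f y ≤ r ∧
    (z.1 : F) = t • (L y - b) ∧ z.2 = t * (r - a)}
  zero_mem' := ⟨1, one_pos, x, a, ha.le, by simp [hx], by simp⟩
  add_mem' := by
    rintro z₁ z₂ ⟨t, ht, y, r, hr, h1, h2⟩ ⟨t', ht', y', r', hr', h1', h2'⟩
    have hs : 0 < t + t' := by positivity
    refine ⟨t + t', hs, (t / (t + t')) • y + (t' / (t + t')) • y', _,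
      hf.le_combo hr hr' (by positivity) (by positivity) (by field_simp), ?_, ?_⟩
    · have e1 : (t + t') * (t / (t + t')) = t := by field_simp
      have e2 : (t + t') * (t' / (t + t')) = t' := by field_simp
      simp only [Prod.fst_add, Submodule.coe_add, h1, h1', map_add, map_smul, smul_sub, smul_add,
        smul_smul, e1, e2, add_smul]
      abel
    · simp only [Prod.snd_add, h2, h2']
      field_simp
      ring
  smul_mem' := by
    rintro ⟨c, hc⟩ z ⟨t, ht, y, r, hr, h1, h2⟩
    -- The factor `t` must stay positive, so the zero multiple is represented by the point `x`
    -- itself.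
    rcases hc.eq_or_lt with rfl | hc'
    · refine ⟨1, one_pos, x, a, ha.le, ?_, ?_⟩
      · change (((0 : ℝ) • z).1 : F) = _
        simp [hx]
      · change ((0 : ℝ) • z).2 = _
        simp
    · refine ⟨c * t, by positivity, y, r, hr, ?_, ?_⟩
      · change ((c • z).1 : F) = _
        simp [h1, smul_smul]
      · change (c • z).2 = _
        simp [h2, mul_assoc]

/-- Existence of Lagrange multipliers under the qualification condition on the strong relative
interior. -/
theorem exists_multiplier [FiniteDimensional ℝ E] [FiniteDimensional ℝ F]
    {f : E → EReal} (hf : IsGammaZero f) (L : E →L[ℝ] F) (b : F) {x : E} (hx : L x = b)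
    (hmin : ∀ y, L y = b → f x ≤ f y)
    (hcq : (0 : F) ∈ sri ((fun y => L y - b) '' effDom f)) :
    ∃ u : F, -(ContinuousLinearMap.adjoint L u) ∈ subdiff f x := by
  obtain ⟨⟨y₀, hy₀, hLy₀⟩, hcone⟩ := hcq
  have hxfin : f x < ⊤ := (hmin y₀ (sub_eq_zero.1 hLy₀)).trans_lt hy₀
  obtain ⟨a, ha⟩ : ∃ a : ℝ, f x = a := ⟨_, (EReal.coe_toReal hxfin.ne (hf.ne_bot x)).symm⟩
  set K : Submodule ℝ F := (Submodule.span ℝ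
    ((fun w => w - 0) '' ((fun y => L y - b) '' effDom f))).topologicalClosure with hK
  have hK1 : ∀ w ∈ K, ∃ t : ℝ, 0 < t ∧ ∃ y, f y < ⊤ ∧ w = t • (L y - b) := by
    intro w hw
    have hw' : w ∈ (K : Set F) := hw
    rw [← hcone] at hw'
    obtain ⟨t, ht, _, ⟨y, hy, rfl⟩, h⟩ := hw'
    exact ⟨t, ht, y, hy, by simpa using h⟩
  have hK2 : ∀ y, f y < ⊤ → L y - b ∈ K := by
    intro y hy
    have : L y - b ∈ (K : Set F) := by
      rw [← hcone]
      exact ⟨1, one_pos, L y - b, ⟨y, hy, rfl⟩, by simp⟩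
    exact this
  let s := perturbationCone f hf L b a x hx ha K
  -- The functional `(0, r) ↦ r`, nonnegative on the cone because `x` is a minimizer. By the
  -- qualification condition any `(w, r)` enters the cone after a vertical shift, so a positive
  -- extension exists.
  let φ : (K × ℝ) →ₗ.[ℝ] ℝ :=
    ⟨Submodule.prod ⊥ ⊤, (LinearMap.snd ℝ K ℝ).comp (Submodule.subtype _)⟩
  obtain ⟨g, hg1, hg2⟩ := riesz_extension s φ (by
    rintro ⟨⟨w, r⟩, hw⟩ ⟨t, ht, y, ρ, hρ, h1, h2⟩
    have hw0 : w = 0 := by simpa using hw.1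
    subst hw0
    have h3 : L y = b := by
      have : t • (L y - b) = 0 := by simpa using h1.symm
      exact sub_eq_zero.1 ((smul_eq_zero.1 this).resolve_left ht.ne')
    have h4 : a ≤ ρ := by
      rw [← EReal.coe_le_coe_iff, ← ha]
      exact (hmin y h3).trans hρ
    change 0 ≤ r
    change r = _ at h2
    rw [h2]
    exact mul_nonneg ht.le (sub_nonneg.2 h4)) (by
    rintro ⟨w, r⟩
    obtain ⟨t, ht, y, hy, h⟩ := hK1 w w.2
    obtain ⟨ρ, hρ⟩ : ∃ ρ : ℝ, f y = ρ := ⟨_, (EReal.coe_toReal hy.ne (hf.ne_bot y)).symm⟩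
    refine ⟨⟨(0, t * (ρ - a) - r), by simp [φ]⟩, t, ht, y, ρ, hρ.le, ?_, ?_⟩
    · simpa using h
    · simp)
  -- Any extension from `K` to `F` will do: `L y - b` lies in `K` whenever `f y` is finite.
  obtain ⟨ℓ, hℓ⟩ := LinearMap.exists_extend (g.comp (LinearMap.inl ℝ K ℝ))
  let u : F := (InnerProductSpace.toDual ℝ F).symm (LinearMap.toContinuousLinearMap ℓ)
  have hu : ∀ w, inner ℝ u w = ℓ w := by
    intro w
    simp [u]
  refine ⟨u, ?_⟩
  rw [mem_subdiff_iff hf.ne_bot]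
  intro y r hr
  rw [ha, EReal.coe_le_coe_iff, inner_neg_left, ContinuousLinearMap.adjoint_inner_left, map_sub,
    hx, hu]
  have hKy : L y - b ∈ K := hK2 y (hr.trans_lt (EReal.coe_lt_top r))
  have h1 := hg2 (⟨L y - b, hKy⟩, r - a) ⟨1, one_pos, y, r, hr, by simp, by simp⟩
  have h2 : g (0, r - a) = r - a := hg1 ⟨(0, r - a), by simp [φ]⟩
  have h3 : ℓ (L y - b) = g (⟨L y - b, hKy⟩, 0) := LinearMap.congr_fun hℓ ⟨L y - b, hKy⟩
  have h4 : g (⟨L y - b, hKy⟩, r - a) = g (⟨L y - b, hKy⟩, 0) + g (0, r - a) := by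
    rw [← map_add]
    simp
  rw [h4, h2, ← h3] at h1
  linarith

end ConvexAnalysis

end ProjCP

namespace ProjCP

/-! ### Energy estimates and convergence of the iteration. -/

section Convergence

variable {E F : Type*} [NormedAddCommGroup E] [InnerProductSpace ℝ E]
  [NormedAddCommGroup F] [InnerProductSpace ℝ F]

/-- The Lyapunov function of the primal-dual iteration, as a function of the primal error, the
dual error and the extrapolation term. -/
noncomputable def lyapunov (L : E →L[ℝ] F) (γ τ : ℝ) (a : E) (w : F) (q : E) : ℝ :=
  τ⁻¹ * ‖a‖ ^ 2 + γ⁻¹ * ‖w‖ ^ 2 + 2 * inner ℝ (L q) w + τ⁻¹ * ‖q‖ ^ 2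

/-- Weighted AM-GM, from the square of `√γ * ‖q‖ - √τ * ‖w‖`. The factor `√(γ * τ) * ‖L‖` is below 1
exactly under the step-size condition, so the quadratic terms absorb the cross term. -/
theorem two_mul_inner_le (L : E →L[ℝ] F) {γ τ : ℝ} (hγ : 0 < γ) (hτ : 0 < τ) (q : E) (w : F) :
    2 * inner ℝ (L q) w ≤ √(γ * τ) * ‖L‖ * (τ⁻¹ * ‖q‖ ^ 2 + γ⁻¹ * ‖w‖ ^ 2) := by
  have h1 : inner ℝ (L q) w ≤ ‖L‖ * (‖q‖ * ‖w‖) := by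
    refine (real_inner_le_norm _ _).trans ?_
    rw [← mul_assoc]
    gcongr
    exact L.le_opNorm q
  have h2 : 2 * (‖q‖ * ‖w‖) ≤ √(γ * τ) * (τ⁻¹ * ‖q‖ ^ 2 + γ⁻¹ * ‖w‖ ^ 2) := by
    rw [Real.sqrt_mul hγ.le]
    have hs := Real.sqrt_pos.2 hγ
    have ht := Real.sqrt_pos.2 hτ
    have hs2 := Real.sq_sqrt hγ.le
    have ht2 := Real.sq_sqrt hτ.le
    set s := √γ
    set t := √τ
    rw [← hs2, ← ht2]
    have e : s * t * ((t ^ 2)⁻¹ * ‖q‖ ^ 2 + (s ^ 2)⁻¹ * ‖w‖ ^ 2) - 2 * (‖q‖ * ‖w‖) =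
        (s * ‖q‖ - t * ‖w‖) ^ 2 / (s * t) := by
      field_simp
      ring
    have : 0 ≤ (s * ‖q‖ - t * ‖w‖) ^ 2 / (s * t) := by positivity
    linarith
  calc 2 * inner ℝ (L q) w ≤ ‖L‖ * (2 * (‖q‖ * ‖w‖)) := by linarith
    _ ≤ ‖L‖ * (√(γ * τ) * (τ⁻¹ * ‖q‖ ^ 2 + γ⁻¹ * ‖w‖ ^ 2)) := by gcongr
    _ = _ := by ring

theorem le_lyapunov (L : E →L[ℝ] F) {γ τ : ℝ} (hγ : 0 < γ) (hτ : 0 < τ)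
    (hθ : √(γ * τ) * ‖L‖ < 1) (a : E) (w : F) (q : E) :
    τ⁻¹ * ‖a‖ ^ 2 + (1 - √(γ * τ) * ‖L‖) * (γ⁻¹ * ‖w‖ ^ 2) ≤ lyapunov L γ τ a w q := by
  have h := two_mul_inner_le L hγ hτ q (-w)
  rw [inner_neg_right, norm_neg] at h
  have h2 : 0 ≤ (1 - √(γ * τ) * ‖L‖) * (τ⁻¹ * ‖q‖ ^ 2) :=
    mul_nonneg (sub_nonneg.2 hθ.le) (by positivity)
  unfold lyapunov
  linarith

/-- Expanding the squares and eliminating `L a` through the dual step leaves `2 * inner ℝ (L q) (w'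
- w)` as the only cross term, which `two_mul_inner_le` absorbs. -/
theorem lyapunov_descent (L : E →L[ℝ] F) {γ τ : ℝ} (hγ : 0 < γ) (hτ : 0 < τ)
    {a P a' q : E} {w w' : F}
    (hmono : 0 ≤ -(τ⁻¹ * inner ℝ (P - a) P) - inner ℝ (L P) w')
    (hdual : w' - w = γ • L (a + q)) (hproj : ‖a'‖ ^ 2 ≤ ‖P‖ ^ 2) :
    lyapunov L γ τ a' w' (P - a) +
        (1 - √(γ * τ) * ‖L‖) * (τ⁻¹ * ‖q‖ ^ 2 + γ⁻¹ * ‖w' - w‖ ^ 2) ≤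
      lyapunov L γ τ a w q := by
  have hc := two_mul_inner_le L hγ hτ q (w' - w)
  have hLa : inner ℝ (L a) w' = γ⁻¹ * inner ℝ (w' - w) w' - inner ℝ (L q) w' := by
    rw [hdual, real_inner_smul_left, map_add, inner_add_left]
    field_simp
    ring
  have hw : ‖w‖ ^ 2 = ‖w'‖ ^ 2 - 2 * inner ℝ (w' - w) w' + ‖w' - w‖ ^ 2 := by
    have := norm_sub_sq_real w' (w' - w)
    rwa [sub_sub_cancel, real_inner_comm] at this
  have ha : ‖a‖ ^ 2 = ‖P‖ ^ 2 - 2 * inner ℝ (P - a) P + ‖P - a‖ ^ 2 := by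
    have := norm_sub_sq_real P (P - a)
    rwa [sub_sub_cancel, real_inner_comm] at this
  have hLP : inner ℝ (L P) w' = inner ℝ (L (P - a)) w' + inner ℝ (L a) w' := by
    rw [← inner_add_left, ← map_add, sub_add_cancel]
  have hp : τ⁻¹ * ‖a'‖ ^ 2 ≤ τ⁻¹ * ‖P‖ ^ 2 := by gcongr
  rw [inner_sub_right] at hc
  unfold lyapunov
  rw [ha, hw]
  linarith

theorem tendsto_zero_of_mul_sq_norm_le {G : Type*} [NormedAddCommGroup G] (g : ℕ → G) (C : ℝ)
    (D : ℕ → ℝ) (hC : 0 < C) (hD : Tendsto D atTop (𝓝 0)) (hle : ∀ k, C * ‖g k‖ ^ 2 ≤ D k) :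
    Tendsto g atTop (𝓝 0) := by
  rw [tendsto_zero_iff_norm_tendsto_zero]
  have h1 : Tendsto (fun k => ‖g k‖ ^ 2) atTop (𝓝 0) := by
    refine squeeze_zero (fun k => by positivity) (fun k => ?_)
      (by simpa using hD.const_mul C⁻¹ : Tendsto (fun k => C⁻¹ * D k) atTop (𝓝 0))
    rw [← div_eq_inv_mul, le_div_iff₀' hC]
    exact hle k
  simpa using h1.sqrt

theorem mem_closedBall_of_mul_sq_norm_le {G : Type*} [NormedAddCommGroup G] (g : ℕ → G) (c : G)
    (C M : ℝ) (hC : 0 < C) (hle : ∀ k, C * ‖g k - c‖ ^ 2 ≤ M) (k : ℕ) :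
    g k ∈ Metric.closedBall c √(C⁻¹ * M) := by
  rw [mem_closedBall_iff_norm]
  refine Real.le_sqrt_of_sq_le ?_
  rw [← div_eq_inv_mul, le_div_iff₀' hC]
  exact hle k

variable [FiniteDimensional ℝ E] [FiniteDimensional ℝ F]

/-- Convergence of the primal-dual iteration with a step in which the primal point `p (k + 1)` is
moved closer to all points of the constraint set. -/
theorem tendsto_of_primal_dual_iteration {f : E → EReal} (hf : IsGammaZero f) (L : E →L[ℝ] F)
    (b : F) {γ τ : ℝ} (hγ : 0 < γ) (hτ : 0 < τ) (hθ : √(γ * τ) * ‖L‖ < 1)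
    {x p xbar : ℕ → E} {u : ℕ → F}
    (hdual : ∀ k, u (k + 1) = u k + γ • (L (xbar k) - b))
    (hprox : ∀ k, IsProx (fun y => (τ : EReal) * f y)
      (x k - τ • ContinuousLinearMap.adjoint L (u (k + 1))) (p (k + 1)))
    (hproj : ∀ k y, L y = b → ‖x (k + 1) - y‖ ^ 2 ≤ ‖p (k + 1) - y‖ ^ 2)
    (hextra : ∀ k, xbar (k + 1) = x (k + 1) + p (k + 1) - x k)
    {x₀ : E} {u₀ : F} (hx₀ : L x₀ = b)
    (hu₀ : -(ContinuousLinearMap.adjoint L u₀) ∈ subdiff f x₀) :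
    ∃ (xh : E) (uh : F), L xh = b ∧ -(ContinuousLinearMap.adjoint L uh) ∈ subdiff f xh ∧
      Tendsto x atTop (𝓝 xh) ∧ Tendsto u atTop (𝓝 uh) := by
  set θ := √(γ * τ) * ‖L‖
  have hθ' : 0 < 1 - θ := sub_pos.2 hθ
  set q : ℕ → E := fun k => xbar k - x k with hq
  have hq1 : ∀ k, q (k + 1) = p (k + 1) - x k := by
    intro k
    simp only [hq, hextra]
    abel
  have hsub : ∀ k, -(τ⁻¹ • q (k + 1)) - ContinuousLinearMap.adjoint L (u (k + 1)) ∈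
      subdiff f (p (k + 1)) := by
    intro k
    have h := (hprox k).mem_subdiff hf hτ
    convert h using 1
    rw [hq1, sub_right_comm, smul_sub τ⁻¹ (x k - p (k + 1)), smul_smul, inv_mul_cancel₀ hτ.ne',
      one_smul, ← smul_neg, neg_sub]
  let V : E → F → ℕ → ℝ := fun y v k => lyapunov L γ τ (x k - y) (u k - v) (q k)
  have hVdesc : ∀ y v, L y = b → -(ContinuousLinearMap.adjoint L v) ∈ subdiff f y → ∀ k,
      V y v (k + 1) + (1 - θ) * (τ⁻¹ * ‖q k‖ ^ 2 + γ⁻¹ * ‖u (k + 1) - u k‖ ^ 2) ≤ V y v k := by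
    intro y v hy hv k
    obtain ⟨r, hr⟩ := (hprox k).exists_real hf hτ
    -- `f y` is finite: the subgradient inequality at `y`, tested at `p (k + 1)`, bounds it above.
    obtain ⟨s, hs⟩ := exists_real_of_le hf.ne_bot
      ((mem_subdiff_iff hf.ne_bot).1 hv _ r hr.le)
    have hm := subdiff_monotone hf hr hs (hsub k) hv
    have h := lyapunov_descent L hγ hτ (a := x k - y) (P := p (k + 1) - y) (a' := x (k + 1) - y)
      (q := q k) (w := u k - v) (w' := u (k + 1) - v) (by
        have e : -(τ⁻¹ • q (k + 1)) - ContinuousLinearMap.adjoint L (u (k + 1)) -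
            -(ContinuousLinearMap.adjoint L v) =
            -(τ⁻¹ • (p (k + 1) - x k)) - ContinuousLinearMap.adjoint L (u (k + 1) - v) := by
          rw [hq1, map_sub]
          abel
        rw [e, inner_sub_left, inner_neg_left, real_inner_smul_left,
          ContinuousLinearMap.adjoint_inner_left] at hm
        rw [sub_sub_sub_cancel_right, real_inner_comm _ (L _)]
        exact hm) (by
        rw [sub_sub_sub_cancel_right, hdual, add_sub_cancel_left, ← hy, ← map_sub]
        congr 2
        simp only [hq]
        abel) (hproj k y hy)
    rw [sub_sub_sub_cancel_right, sub_sub_sub_cancel_right, ← hq1] at h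
    exact h
  have hVlow : ∀ y v k, τ⁻¹ * ‖x k - y‖ ^ 2 + (1 - θ) * (γ⁻¹ * ‖u k - v‖ ^ 2) ≤ V y v k :=
    fun y v k => le_lyapunov L hγ hτ hθ _ _ _
  have hnn : ∀ y v k, 0 ≤ V y v k := fun y v k => le_trans (by positivity) (hVlow y v k)
  have hanti : ∀ y v, L y = b → -(ContinuousLinearMap.adjoint L v) ∈ subdiff f y →
      Antitone (V y v) := by
    intro y v hy hv
    refine antitone_nat_of_succ_le fun k => le_trans ?_ (hVdesc y v hy hv k)
    exact le_add_of_nonneg_right (by positivity)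
  have hlim : ∀ y v, L y = b → -(ContinuousLinearMap.adjoint L v) ∈ subdiff f y →
      ∃ l, Tendsto (V y v) atTop (𝓝 l) := fun y v hy hv =>
    ⟨_, tendsto_atTop_ciInf (hanti y v hy hv) ⟨0, by rintro _ ⟨k, rfl⟩; exact hnn y v k⟩⟩
  obtain ⟨l, hl⟩ := hlim x₀ u₀ hx₀ hu₀
  have hdiff : Tendsto (fun k => V x₀ u₀ k - V x₀ u₀ (k + 1)) atTop (𝓝 0) := by
    simpa using hl.sub (hl.comp (tendsto_add_atTop_nat 1))
  have hq0 : Tendsto q atTop (𝓝 0) := by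
    refine tendsto_zero_of_mul_sq_norm_le q ((1 - θ) * τ⁻¹) _ (by positivity) hdiff fun k => ?_
    have h := hVdesc x₀ u₀ hx₀ hu₀ k
    have : 0 ≤ (1 - θ) * (γ⁻¹ * ‖u (k + 1) - u k‖ ^ 2) := by positivity
    linarith
  have hu0 : Tendsto (fun k => u (k + 1) - u k) atTop (𝓝 0) := by
    refine tendsto_zero_of_mul_sq_norm_le _ ((1 - θ) * γ⁻¹) _ (by positivity) hdiff fun k => ?_
    have h := hVdesc x₀ u₀ hx₀ hu₀ k
    have : 0 ≤ (1 - θ) * (τ⁻¹ * ‖q k‖ ^ 2) := by positivity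
    linarith
  have hbound : ∀ k, V x₀ u₀ k ≤ V x₀ u₀ 0 := fun k => hanti x₀ u₀ hx₀ hu₀ (Nat.zero_le k)
  have hxb := mem_closedBall_of_mul_sq_norm_le x x₀ τ⁻¹ (V x₀ u₀ 0) (by positivity) fun k => by
    have h := (hVlow x₀ u₀ k).trans (hbound k)
    have : 0 ≤ (1 - θ) * (γ⁻¹ * ‖u k - u₀‖ ^ 2) := by positivity
    linarith
  have hub := mem_closedBall_of_mul_sq_norm_le u u₀ ((1 - θ) * γ⁻¹) (V x₀ u₀ 0) (by positivity) fun k => by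
    have h := (hVlow x₀ u₀ k).trans (hbound k)
    have : 0 ≤ τ⁻¹ * ‖x k - x₀‖ ^ 2 := by positivity
    linarith
  have : ProperSpace (E × F) := FiniteDimensional.proper ℝ (E × F)
  obtain ⟨⟨xh, uh⟩, -, φ, hφ, hconv⟩ := tendsto_subseq_of_bounded
    (Metric.isBounded_closedBall.prod Metric.isBounded_closedBall)
    (x := fun k => (x k, u k)) (fun k => Set.mk_mem_prod (hxb k) (hub k))
  have hxφ : Tendsto (fun j => x (φ j)) atTop (𝓝 xh) := (continuous_fst.tendsto _).comp hconv
  have huφ : Tendsto (fun j => u (φ j)) atTop (𝓝 uh) := (continuous_snd.tendsto _).comp hconv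
  have hφt := hφ.tendsto_atTop
  have hqφ : Tendsto (fun j => q (φ j)) atTop (𝓝 0) := hq0.comp hφt
  have hqφ1 : Tendsto (fun j => q (φ j + 1)) atTop (𝓝 0) :=
    (hq0.comp (tendsto_add_atTop_nat 1)).comp hφt
  have huφ0 : Tendsto (fun j => u (φ j + 1) - u (φ j)) atTop (𝓝 0) := hu0.comp hφt
  -- The dual increments are `γ` times the constraint residuals and they vanish.
  have hLxh : L xh = b := by
    have h1 : Tendsto (fun j => γ • (L (x (φ j) + q (φ j)) - b)) atTop
        (𝓝 (γ • (L (xh + 0) - b))) :=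
      (((L.continuous.tendsto _).comp (hxφ.add hqφ)).sub_const b).const_smul γ
    have h2 : (fun j => γ • (L (x (φ j) + q (φ j)) - b)) =
        fun j => u (φ j + 1) - u (φ j) := by
      funext j
      rw [hdual, add_sub_cancel_left]
      simp [hq]
    rw [h2] at h1
    have h3 := tendsto_nhds_unique h1 huφ0
    rw [add_zero] at h3
    exact sub_eq_zero.1 ((smul_eq_zero.1 h3).resolve_left hγ.ne')
  have huh : -(ContinuousLinearMap.adjoint L uh) ∈ subdiff f xh := by
    have hpφ : Tendsto (fun j => p (φ j + 1)) atTop (𝓝 xh) := by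
      have h := hxφ.add hqφ1
      rw [add_zero] at h
      refine h.congr fun j => ?_
      rw [hq1]
      abel
    have huφ1 : Tendsto (fun j => u (φ j + 1)) atTop (𝓝 uh) := by
      have h := huφ.add huφ0
      rw [add_zero] at h
      exact h.congr fun j => by abel
    refine mem_subdiff_of_tendsto hf hpφ ?_ fun j => hsub (φ j)
    have h := (hqφ1.const_smul τ⁻¹).neg.sub
      (((ContinuousLinearMap.adjoint L).continuous.tendsto uh).comp huφ1)
    simpa using h
  -- Rebase the energy at the cluster point, now known to be a saddle point: its limit exists and is
  -- identified along the subsequence.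
  have hV0 : Tendsto (V xh uh) atTop (𝓝 0) := by
    obtain ⟨l', hl'⟩ := hlim xh uh hLxh huh
    have hcont : Continuous fun z : E × F × E => lyapunov L γ τ (z.1 - xh) (z.2.1 - uh) z.2.2 := by
      unfold lyapunov
      fun_prop
    have h1 := (hcont.tendsto (xh, uh, 0)).comp (hxφ.prodMk_nhds (huφ.prodMk_nhds hqφ))
    have h2 : lyapunov L γ τ (xh - xh) (uh - uh) 0 = 0 := by simp [lyapunov]
    simp only [h2] at h1
    have h3 := tendsto_nhds_unique (hl'.comp hφt) h1
    rwa [h3] at hl'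
  refine ⟨xh, uh, hLxh, huh, ?_, ?_⟩
  · rw [← tendsto_sub_nhds_zero_iff]
    refine tendsto_zero_of_mul_sq_norm_le _ τ⁻¹ _ (by positivity) hV0 fun k => ?_
    have h := hVlow xh uh k
    have : 0 ≤ (1 - θ) * (γ⁻¹ * ‖u k - uh‖ ^ 2) := by positivity
    linarith
  · rw [← tendsto_sub_nhds_zero_iff]
    refine tendsto_zero_of_mul_sq_norm_le _ ((1 - θ) * γ⁻¹) _ (by positivity) hV0 fun k => ?_
    have h := hVlow xh uh k
    have : 0 ≤ τ⁻¹ * ‖x k - xh‖ ^ 2 := by positivity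
    linarith

end Convergence

/-! ### Stacked constraints and the affine projection. -/

section Matrices

variable {N m n : ℕ}

theorem stackOp_eq_stackVec_iff {R : Matrix (Fin m) (Fin N) ℝ} {S : Matrix (Fin n) (Fin N) ℝ}
    {c : EuclideanSpace ℝ (Fin m)} {d : EuclideanSpace ℝ (Fin n)} {x : EuclideanSpace ℝ (Fin N)} :
    stackOp R S x = stackVec c d ↔ matCLM R x = c ∧ matCLM S x = d := by
  have hl : ∀ i, stackOp R S x (Sum.inl i) = matCLM R x i := fun _ => rfl
  have hr : ∀ i, stackOp R S x (Sum.inr i) = matCLM S x i := fun _ => rfl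
  constructor
  · intro h
    constructor
    · ext i
      rw [← hl, h]
      rfl
    · ext i
      rw [← hr, h]
      rfl
  · rintro ⟨h1, h2⟩
    ext (i | i)
    · rw [hl, h1]
      rfl
    · rw [hr, h2]
      rfl

theorem matCLM_mul_apply {ι κ μ : Type*} [Fintype ι] [Fintype κ] [Fintype μ] [DecidableEq κ]
    [DecidableEq μ] (A : Matrix ι κ ℝ) (B : Matrix κ μ ℝ) (x : EuclideanSpace ℝ μ) :
    matCLM (A * B) x = matCLM A (matCLM B x) :=
  LinearMap.congr_fun (Matrix.toLpLin_mul 2 2 2 A B) x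

theorem inner_matCLM_transpose {ι κ : Type*} [Fintype ι] [Fintype κ] [DecidableEq ι]
    [DecidableEq κ] (A : Matrix ι κ ℝ) (v : EuclideanSpace ℝ ι) (x : EuclideanSpace ℝ κ) :
    inner ℝ (matCLM A.transpose v) x = inner ℝ v (matCLM A x) := by
  have h := LinearMap.congr_fun (Matrix.toEuclideanLin_conjTranspose_eq_adjoint A) v
  rw [Matrix.conjTranspose_eq_transpose_of_trivial] at h
  calc inner ℝ (matCLM A.transpose v) x
      = inner ℝ (LinearMap.adjoint (Matrix.toEuclideanLin A) v) x := by rw [← h]; rfl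
    _ = _ := LinearMap.adjoint_inner_left _ _ _

/-- The map `p ↦ p - Rᵀ (R Rᵀ)⁻¹ (R p - c)` does not increase the distance to the points of the
affine subspace `{R y = c}`. -/
theorem norm_affine_projection_sub_le {R : Matrix (Fin m) (Fin N) ℝ}
    (hR : IsUnit (R * R.transpose)) {c : EuclideanSpace ℝ (Fin m)}
    {p x y : EuclideanSpace ℝ (Fin N)}
    (hx : x = p - matCLM R.transpose (matCLM (R * R.transpose)⁻¹ (matCLM R p - c)))
    (hy : matCLM R y = c) : ‖x - y‖ ^ 2 ≤ ‖p - y‖ ^ 2 := by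
  set v := matCLM (R * R.transpose)⁻¹ (matCLM R p - c) with hv
  have hRv : matCLM R (matCLM R.transpose v) = matCLM R p - c := by
    rw [← matCLM_mul_apply, hv, ← matCLM_mul_apply,
      Matrix.mul_nonsing_inv _ ((Matrix.isUnit_iff_isUnit_det _).1 hR)]
    exact LinearMap.congr_fun (Matrix.toLpLin_one 2) _
  have hxy : matCLM R (x - y) = 0 := by
    rw [hx, map_sub, map_sub, hRv, hy]
    abel
  -- Pythagoras: `x - y` lies in the kernel of `R`, which is orthogonal to the range of its
  -- transpose.
  have e : p - y = (x - y) + matCLM R.transpose v := by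
    rw [hx]
    abel
  rw [e, norm_add_sq_real, real_inner_comm, inner_matCLM_transpose, hxy, inner_zero_right]
  nlinarith [sq_nonneg ‖matCLM R.transpose v‖]

end Matrices

end ProjCP

theorem corollary1 {N m n : ℕ}
    (f : EuclideanSpace ℝ (Fin N) → EReal) (hf : ProjCP.IsGammaZero f)
    (R : Matrix (Fin m) (Fin N) ℝ) (S : Matrix (Fin n) (Fin N) ℝ)
    (c : EuclideanSpace ℝ (Fin m)) (d : EuclideanSpace ℝ (Fin n))
    (hR : IsUnit (R * R.transpose))
    (hsol : ∃ z, ProjCP.IsSolution f R S c d z)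
    (hcq : (0 : EuclideanSpace ℝ (Fin m ⊕ Fin n)) ∈
      ProjCP.sri ((fun y => ProjCP.stackOp R S y - ProjCP.stackVec c d) '' ProjCP.effDom f))
    (γ τ : ℝ) (hγ : 0 < γ) (hτ : 0 < τ) (hstep : γ * τ * ‖ProjCP.stackOp R S‖ ^ 2 < 1)
    (x p xbar : ℕ → EuclideanSpace ℝ (Fin N))
    (u : ℕ → EuclideanSpace ℝ (Fin m ⊕ Fin n))
    (hiter : ProjCP.IsRoutine f R S c d γ τ x p xbar u) :
    ∃ (xhat : EuclideanSpace ℝ (Fin N)) (uhat : EuclideanSpace ℝ (Fin m ⊕ Fin n)),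
      ProjCP.IsSolution f R S c d xhat ∧ ProjCP.IsMultiplier f R S xhat uhat ∧
        Filter.Tendsto x Filter.atTop (nhds xhat) ∧
        Filter.Tendsto u Filter.atTop (nhds uhat) := by
  obtain ⟨z, hz1, hz2, hzmin⟩ := hsol
  have hz := ProjCP.stackOp_eq_stackVec_iff.2 ⟨hz1, hz2⟩
  obtain ⟨u₀, hu₀⟩ := ProjCP.exists_multiplier hf (ProjCP.stackOp R S) _ hz (fun y hy =>
    let h := ProjCP.stackOp_eq_stackVec_iff.1 hy
    hzmin y h.1 h.2) hcq
  have hθ : √(γ * τ) * ‖ProjCP.stackOp R S‖ < 1 := by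
    rw [← sq_lt_one_iff₀ (by positivity), mul_pow, Real.sq_sqrt (by positivity)]
    exact hstep
  obtain ⟨xh, uh, hL, hm, hxt, hut⟩ := ProjCP.tendsto_of_primal_dual_iteration hf
    (ProjCP.stackOp R S) _ hγ hτ hθ hiter.dual_step hiter.prox_step
    (fun k y hy => ProjCP.norm_affine_projection_sub_le hR (hiter.proj_step k)
      (ProjCP.stackOp_eq_stackVec_iff.1 hy).1) hiter.extrap_step hz hu₀
  have hfeas := ProjCP.stackOp_eq_stackVec_iff.1 hL
  refine ⟨xh, uh, ⟨hfeas.1, hfeas.2, fun y h1 h2 => ?_⟩, hm, hxt, hut⟩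
  -- For feasible `y` the linear term of the subgradient inequality vanishes, so the multiplier
  -- certifies optimality.
  have h := hm y
  rw [inner_neg_left, ContinuousLinearMap.adjoint_inner_left, map_sub, hL,
    ProjCP.stackOp_eq_stackVec_iff.2 ⟨h1, h2⟩, sub_self, inner_zero_right] at h
  simpa using h
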